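/- Consider a finite system of sporadic tasks with arbitrary deadlines on one processor. Task $\tau_i$ has worst-case execution time $C_i>0$, minimum inter-release time (period) $T_i>0$, relative deadline $D_i>0$ and utilization $U_i=C_i/T_i$; each of its jobs executes for at most $C_i$ time units, and its jobs are executed in sequence. The tasks are scheduled by preemptive rate-monotonic scheduling: at any time a pending job of the highest-priority task is executed, and tasks with smaller periods have higher priority, ties being broken arbitrarily but fixed. Let $\tau_1,\dots,\tau_{k-1}$, with $k\ge 2$, be the tasks with higher priority than $\tau_k$ (there may also be tasks with lower priority), and let $\beta=T_k/D_k$. Then $\tau_k$ is schedulable, i.e. in every schedule each of its jobs finishes within $D_k$ time units of its release, if at least one of the following two conditions holds. (1) $$\sum_{i=1}^{k-1}U_i\le\frac{k-1}{\beta k}\left(1+\beta-\sqrt{1+\beta^2+2\beta^2U_k\frac{k}{k-1}}\right),$$ and in addition, in the case $\beta<1$, the total utilization satisfies $\sum_{i=1}^{k}U_i\le 1$. (For $\beta\ge1$ this follows from the displayed inequality.) (2) $$\sum_{i=1}^{k}U_i\le\begin{cases}\dfrac{k-1}{\beta k}\left(1+\beta-\sqrt{1+\beta^2-\dfrac{2\beta}{k-1}}\right),&\text{if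 }k>2\beta+1,\\[2ex]\dfrac1\beta-\dfrac{k-1}{2\beta^2k},&\text{otherwise.}\end{cases}$$ -/

import Mathlib

open MeasureTheory

/-- A sporadic task: worst-case execution time `C`, minimum inter-release time (period) `T` and
relative deadline `D`.  No relation between `D` and `T` is imposed (arbitrary deadlines). -/
structure SporadicTask where
  C : ℝ
  T : ℝ
  D : ℝ
  C_pos : 0 < C
  T_pos : 0 < T
  D_pos : 0 < D

namespace SporadicTask

/-- The utilization `U = C / T`. -/
noncomputable def U (a : SporadicTask) : ℝ := a.C / a.T

end SporadicTask

/-- A job pattern generated by the task system `τ`: the `j`-th job of task `i` is released at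
time `r i j` and executes for `c i j` time units.  (A task that stops releasing jobs is covered by
letting all its remaining jobs have execution time `0`.) -/
structure JobPattern {ι : Type*} (τ : ι → SporadicTask) where
  /-- release times -/
  r : ι → ℕ → ℝ
  /-- actual execution times -/
  c : ι → ℕ → ℝ
  r_nonneg : ∀ i j, 0 ≤ r i j
  r_sep : ∀ i j, r i j + (τ i).T ≤ r i (j + 1)
  c_nonneg : ∀ i j, 0 ≤ c i j
  c_le : ∀ i j, c i j ≤ (τ i).C

/-- The amount of processor time that the job `J` (job number `J.2` of task `J.1`) has received
before time `t`, when `σ s` is the job executed by the processor at time `s` (`none` if idle). -/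
noncomputable def service {ι : Type*} (σ : ℝ → Option (ι × ℕ)) (J : ι × ℕ) (t : ℝ) : ℝ :=
  (volume (Set.Ico 0 t ∩ {s | σ s = some J})).toReal

/-- The job `J` is pending at time `t`: it has been released and is not finished. -/
def Pending {ι : Type*} {τ : ι → SporadicTask} (P : JobPattern τ)
    (σ : ℝ → Option (ι × ℕ)) (J : ι × ℕ) (t : ℝ) : Prop :=
  P.r J.1 J.2 ≤ t ∧ service σ J t < P.c J.1 J.2

/-- `σ` is the uniprocessor preemptive fixed-priority schedule of the job pattern `P`, where
`prio i < prio i'` means that task `i` has higher priority than task `i'`. At any time the processor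
executes a pending job of the highest-priority task that has one, jobs of the same task are executed
in sequence, and the processor idles only if no job is pending. -/
structure IsFixedPrioritySchedule {ι : Type*} {τ : ι → SporadicTask} (prio : ι → ℕ)
    (P : JobPattern τ) (σ : ℝ → Option (ι × ℕ)) : Prop where
  measurable : ∀ J : ι × ℕ, MeasurableSet {t | σ t = some J}
  pending_of_run : ∀ t J, σ t = some J → Pending P σ J t
  highest_of_run : ∀ t J, σ t = some J → ∀ J', Pending P σ J' t →
    prio J.1 < prio J'.1 ∨ (J.1 = J'.1 ∧ J.2 ≤ J'.2)
  idle : ∀ t, σ t = none → ∀ J, ¬ Pending P σ J t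

/-- Task `k` is schedulable under preemptive fixed-priority scheduling on one processor: for every
job pattern of the task system, each job of task `k` is finished by its absolute deadline. -/
def Schedulable {ι : Type*} (τ : ι → SporadicTask) (prio : ι → ℕ) (k : ι) : Prop :=
  ∀ (P : JobPattern τ) (σ : ℝ → Option (ι × ℕ)), IsFixedPrioritySchedule prio P σ →
    ∀ j : ℕ, P.c k j ≤ service σ (k, j) (P.r k j + (τ k).D)

/-- `prio` is a rate-monotonic priority assignment: the priorities of distinct tasks are distinct,
and tasks with smaller periods have higher priority (ties are broken arbitrarily). -/
structure IsRateMonotonic {ι : Type*} (τ : ι → SporadicTask) (prio : ι → ℕ) : Prop where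
  injective : Function.Injective prio
  lt_of_period_lt : ∀ i i', (τ i).T < (τ i').T → prio i < prio i'

/-- The set of the tasks with higher priority than task `k`. -/
def higherPriority {ι : Type*} [Fintype ι] (prio : ι → ℕ) (k : ι) : Finset ι :=
  Finset.univ.filter (fun i => prio i < prio k)

/-! If a job misses its deadline, go back to the last instant `s` before which all work of level `κ`
or higher released earlier is done. From there to the deadline demand exceeds supply: with `n` jobs
of task `κ` in the window and `L = (n-1)T_κ + D_κ`, every `0 < t ≤ L` satisfies `t < nC_κ + Σ
C_i⌈t/T_i⌉` (`exists_busy_window`). Using this at `L` and at the last multiple `t_i < L` of each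
`T_i`, and averaging with weights `u_i = C_i/T_i`, bounds `L` quadratically in the `u_i`
(`busy_length_lt`). Cauchy–Schwarz gives `Σ u_i² ≥ S²/(k-1)`, and `S + U ≤ 1` makes `n = 1` the
worst case, which contradicts `QuadraticTest`. Condition (1) is the smaller root in `S` of that
quadratic set equal to `q = (k-1)/k ≤ 1`. Condition (2) covers the worst split of `S + U`, found by
maximizing the concave `S - βS²/(2q)`. -/

section Service

variable {ι : Type*} {σ : ℝ → Option (ι × ℕ)}

lemma service_eq_real (J : ι × ℕ) (t : ℝ) :
    service σ J t = volume.real (Set.Ico 0 t ∩ {s | σ s = some J}) := rfl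

lemma volume_executed_ne_top (J : ι × ℕ) (t : ℝ) :
    volume (Set.Ico 0 t ∩ {s | σ s = some J}) ≠ ⊤ :=
  ((measure_mono Set.inter_subset_left).trans_lt
    (by rw [Real.volume_Ico]; exact ENNReal.ofReal_lt_top)).ne

lemma service_mono (J : ι × ℕ) : Monotone (service σ J) := fun _ t hst =>
  measureReal_mono (Set.inter_subset_inter_left _ (Set.Ico_subset_Ico_right hst))
    (volume_executed_ne_top J t)

/-- If a job does not run in `(x, t)`, then it receives at most `x - s` units of service
in `[s, t)`. -/
lemma service_le_add {J : ι × ℕ} {s x t : ℝ} (hsx : s ≤ x)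
    (h : ∀ y, x < y → y < t → σ y ≠ some J) :
    service σ J t ≤ service σ J s + (x - s) := by
  have hsub : Set.Ico 0 t ∩ {y | σ y = some J} ⊆
      (Set.Ico 0 s ∩ {y | σ y = some J}) ∪ Set.Icc s x := by
    rintro y ⟨⟨hy0, hyt⟩, hy⟩
    by_cases hys : y < s
    · exact Or.inl ⟨⟨hy0, hys⟩, hy⟩
    · refine Or.inr ⟨not_lt.1 hys, ?_⟩
      by_contra hxy
      exact h y (not_le.1 hxy) hyt hy
  calc service σ J t
      ≤ volume.real ((Set.Ico 0 s ∩ {y | σ y = some J}) ∪ Set.Icc s x) :=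
        measureReal_mono hsub
          (measure_union_ne_top (volume_executed_ne_top J s)
            (by rw [Real.volume_Icc]; exact ENNReal.ofReal_ne_top))
    _ ≤ service σ J s + volume.real (Set.Icc s x) := measureReal_union_le _ _
    _ = service σ J s + (x - s) := by rw [Real.volume_real_Icc_of_le hsx]

end Service

/-! ### Job counts and the busy window. -/

section Schedule

variable {ι : Type*} {τ : ι → SporadicTask} {prio : ι → ℕ} {P : JobPattern τ}
  {σ : ℝ → Option (ι × ℕ)}

/-- No job receives more service than its execution time. -/
lemma IsFixedPrioritySchedule.service_le (hσ : IsFixedPrioritySchedule prio P σ)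
    (J : ι × ℕ) (t : ℝ) : service σ J t ≤ P.c J.1 J.2 := by
  set E : Set ℝ := Set.Ico 0 t ∩ {s | σ s = some J} with hE
  rcases E.eq_empty_or_nonempty with h0 | hne
  · rw [service_eq_real, ← hE, h0, measureReal_empty]
    exact P.c_nonneg _ _
  · have hbdd : BddAbove E := ⟨t, fun y hy => hy.1.2.le⟩
    refine le_of_forall_pos_le_add fun ε hε => ?_
    -- The job is still unfinished at a running instant within `ε` of the supremum, and can gain at
    -- most `ε` afterwards.
    obtain ⟨s, hsE, hs⟩ := exists_lt_of_lt_csSup hne (sub_lt_self (sSup E) hε)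
    have hrun := (hσ.pending_of_run s J hsE.2).2
    have := service_le_add (σ := σ) (J := J) (t := t) (le_csSup hbdd hsE) (fun y hy hyt hJ => by
      refine hy.not_ge (le_csSup hbdd ⟨⟨?_, hyt⟩, hJ⟩)
      exact (P.r_nonneg _ _).trans (hσ.pending_of_run y J hJ).1)
    linarith

lemma JobPattern.add_mul_period_le (P : JobPattern τ) (i : ι) (m l : ℕ) :
    P.r i m + l * (τ i).T ≤ P.r i (m + l) := by
  induction l with
  | zero => simp
  | succ l ih =>
    have := P.r_sep i (m + l)
    push_cast
    rw [← add_assoc m l 1]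
    linarith

lemma JobPattern.sub_mul_period_le (P : JobPattern τ) (i : ι) {m l : ℕ} (h : m ≤ l) :
    ((l : ℝ) - m) * (τ i).T ≤ P.r i l - P.r i m := by
  obtain ⟨q, rfl⟩ := Nat.exists_eq_add_of_le h
  have := P.add_mul_period_le i m q
  push_cast
  linarith

lemma JobPattern.strictMono_r (P : JobPattern τ) (i : ι) : StrictMono (P.r i) :=
  strictMono_nat_of_lt_succ fun m => by linarith [P.r_sep i m, (τ i).T_pos]

/-- The jobs of a task in a finite set span at least the number of jobs minus one periods. -/
lemma JobPattern.exists_card_sub_one_mul_le (P : JobPattern τ) (i : ι) {S : Finset ℕ}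
    (hS : S.Nonempty) :
    ∃ m ∈ S, ∃ l ∈ S, ((S.card : ℝ) - 1) * (τ i).T ≤ P.r i l - P.r i m := by
  refine ⟨S.min' hS, S.min'_mem hS, S.max' hS, S.max'_mem hS, ?_⟩
  have hle : S.min' hS ≤ S.max' hS := S.min'_le _ (S.max'_mem hS)
  have hcard : S.card ≤ S.max' hS + 1 - S.min' hS := by
    rw [← Nat.card_Icc]
    exact Finset.card_le_card fun x hx => Finset.mem_Icc.2 ⟨S.min'_le x hx, S.le_max' x hx⟩
  have hcard' : (S.card : ℝ) + (S.min' hS : ℕ) ≤ (S.max' hS : ℕ) + 1 := by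
    exact_mod_cast (by omega : S.card + S.min' hS ≤ S.max' hS + 1)
  refine le_trans ?_ (P.sub_mul_period_le i hle)
  exact mul_le_mul_of_nonneg_right (by linarith) (τ i).T_pos.le

/-- At most `⌈(e - s) / T⌉` jobs of a task are released in `[s, e)`. -/
lemma JobPattern.card_le_ceil (P : JobPattern τ) (i : ι) {S : Finset ℕ} {s e : ℝ}
    (h : ∀ m ∈ S, s ≤ P.r i m ∧ P.r i m < e) : S.card ≤ ⌈(e - s) / (τ i).T⌉₊ := by
  rcases S.eq_empty_or_nonempty with rfl | hS
  · simp
  · obtain ⟨m, hm, l, hl, hml⟩ := P.exists_card_sub_one_mul_le i hS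
    have h1 := (h m hm).1
    have h2 := (h l hl).2
    obtain ⟨q, hq⟩ := Nat.exists_eq_succ_of_ne_zero (Finset.card_pos.2 hS).ne'
    rw [hq] at hml ⊢
    refine Nat.succ_le_of_lt (Nat.lt_ceil.2 ?_)
    rw [lt_div_iff₀ (τ i).T_pos]
    push_cast at hml
    linarith

/-- If a job misses its deadline `d`, then there is a level-`κ` busy window `[s, d)` containing it
such that the workload released in `[s, e)` by the tasks of higher priority, together with
`n` jobs of task `κ`, exceeds `e - s` for each `e` in the window. -/
lemma IsFixedPrioritySchedule.exists_busy_window [Fintype ι]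
    (hσ : IsFixedPrioritySchedule prio P σ) (hprio : Function.Injective prio)
    {κ : ι} {j : ℕ} {d : ℝ} (had : P.r κ j ≤ d) (hmiss : service σ (κ, j) d < P.c κ j) :
    ∃ (s : ℝ) (n : ℕ), 1 ≤ n ∧ ((n : ℝ) - 1) * (τ κ).T ≤ P.r κ j - s ∧
      ∀ e, s < e → e ≤ d → e - s < n * (τ κ).C +
        ∑ i ∈ higherPriority prio κ, (τ i).C * (⌈(e - s) / (τ i).T⌉₊ : ℝ) := by
  -- Instants with no backlog of level `κ` or higher. As only releases strictly before `t` count,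
  -- the supremum again has no backlog.
  set A : Set ℝ := {t | 0 ≤ t ∧ t ≤ P.r κ j ∧
    ∀ i m, prio i ≤ prio κ → P.r i m < t → P.c i m ≤ service σ (i, m) t} with hA
  have hA0 : (0 : ℝ) ∈ A :=
    ⟨le_rfl, P.r_nonneg _ _, fun i m _ h => absurd h (P.r_nonneg i m).not_gt⟩
  have hbdd : BddAbove A := ⟨P.r κ j, fun t ht => ht.2.1⟩
  set s := sSup A with hs
  have hs0 : 0 ≤ s := le_csSup hbdd hA0
  have hsa : s ≤ P.r κ j := csSup_le ⟨0, hA0⟩ fun t ht => ht.2.1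
  have hsfree : ∀ i m, prio i ≤ prio κ → P.r i m < s → P.c i m ≤ service σ (i, m) s := by
    intro i m hi hr
    obtain ⟨t, ht, hrt⟩ := exists_lt_of_lt_csSup ⟨0, hA0⟩ hr
    exact (ht.2.2 i m hi hrt).trans (service_mono _ (le_csSup hbdd ht))
  have hpend : ∀ t, P.r κ j ≤ t → t < d → Pending P σ (κ, j) t := fun t h1 h2 =>
    ⟨h1, (service_mono _ h2.le).trans_lt hmiss⟩
  have hrun : ∀ t, s < t → t < d → ∃ J : ι × ℕ, σ t = some J ∧ s ≤ P.r J.1 J.2 ∧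
      P.r J.1 J.2 ≤ t ∧ (prio J.1 < prio κ ∨ (J.1 = κ ∧ J.2 ≤ j)) := by
    intro t hst htd
    have key : ∃ J', Pending P σ J' t ∧ prio J'.1 ≤ prio κ := by
      by_cases hta : P.r κ j ≤ t
      · exact ⟨(κ, j), hpend t hta htd, le_rfl⟩
      · have hnot : t ∉ A := fun h => hst.not_ge (le_csSup hbdd h)
        simp only [hA, Set.mem_ofPred_eq, not_and, not_forall] at hnot
        obtain ⟨i, m, hi, hr, hc⟩ := hnot (hs0.trans hst.le) (not_le.1 hta).le
        exact ⟨(i, m), ⟨hr.le, not_le.1 hc⟩, hi⟩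
    obtain ⟨J', hJ', hJp⟩ := key
    cases hJ : σ t with
    | none => exact absurd hJ' (hσ.idle t hJ J')
    | some J =>
      have hP := hσ.pending_of_run t J hJ
      have hle : prio J.1 ≤ prio κ := by
        rcases hσ.highest_of_run t J hJ J' hJ' with h | h
        · exact h.le.trans hJp
        · rw [h.1]; exact hJp
      refine ⟨J, rfl, ?_, hP.1, ?_⟩
      · by_contra hr
        exact hP.2.not_ge ((hsfree J.1 J.2 hle (not_le.1 hr)).trans (service_mono _ hst.le))
      · rcases hle.lt_or_eq with h | h
        · exact Or.inl h
        · have hκ : J.1 = κ := hprio h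
          refine Or.inr ⟨hκ, ?_⟩
          by_cases hta : P.r κ j ≤ t
          · rcases hσ.highest_of_run t J hJ _ (hpend t hta htd) with h' | h'
            · exact absurd h h'.ne
            · exact h'.2
          · have h1 := hP.1
            rw [hκ] at h1
            exact ((P.strictMono_r κ).lt_iff_lt.1 (h1.trans_lt (not_le.1 hta))).le
  set K : Finset ℕ := (Finset.range (j + 1)).filter fun m => s ≤ P.r κ m with hK
  have hjK : j ∈ K := by simp [hK, hsa]
  have hKne : K.Nonempty := ⟨j, hjK⟩
  refine ⟨s, K.card, Finset.card_pos.2 hKne, ?_, fun e hse hed => ?_⟩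
  · obtain ⟨m, hm, l, hl, h⟩ := P.exists_card_sub_one_mul_le κ hKne
    have h1 : s ≤ P.r κ m := (Finset.mem_filter.1 hm).2
    have h2 : P.r κ l ≤ P.r κ j := (P.strictMono_r κ).monotone
      (Nat.lt_succ_iff.1 (Finset.mem_range.1 (Finset.mem_filter.1 hl).1))
    linarith
  · have hN : ∀ i, ∃ N : ℕ, ∀ m, P.r i m < e → m < N := fun i => by
      obtain ⟨N, hN⟩ := exists_nat_gt (e / (τ i).T)
      refine ⟨N, fun m hm => ?_⟩
      have h1 := P.add_mul_period_le i 0 m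
      have h2 := P.r_nonneg i 0
      rw [zero_add] at h1
      have h3 : (m : ℝ) < e / (τ i).T := by
        rw [lt_div_iff₀ (τ i).T_pos]; linarith
      exact_mod_cast h3.trans hN
    choose N hN using hN
    set F : ι → Finset ℕ := fun i =>
      (Finset.range (N i)).filter fun m => s ≤ P.r i m ∧ P.r i m < e with hF
    let run : ι → ℕ → Set ℝ := fun i m => Set.Ico 0 e ∩ {y | σ y = some (i, m)}
    have hcover : Set.Ioo s e ⊆ (⋃ m ∈ K, run κ m) ∪
        ⋃ i ∈ higherPriority prio κ, ⋃ m ∈ F i, run i m := by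
      rintro t ⟨hst, hte⟩
      obtain ⟨⟨i, m⟩, hJ, hr, hrt, h | ⟨h, hmj⟩⟩ := hrun t hst (hte.trans_le hed)
      · refine Or.inr (Set.mem_biUnion (x := i) (by simpa [higherPriority] using h) ?_)
        have hre := hrt.trans_lt hte
        exact Set.mem_biUnion (x := m) (by simp [hF, hN i m hre, hr, hre])
          ⟨⟨hs0.trans hst.le, hte⟩, hJ⟩
      · obtain rfl : i = κ := h
        exact Or.inl (Set.mem_biUnion (x := m)
          (by simpa [hK, Nat.lt_succ_iff] using ⟨hmj, hr⟩) ⟨⟨hs0.trans hst.le, hte⟩, hJ⟩)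
    have hfin : volume ((⋃ m ∈ K, run κ m) ∪
        ⋃ i ∈ higherPriority prio κ, ⋃ m ∈ F i, run i m) ≠ ⊤ := by
      refine ne_top_of_le_ne_top (b := volume (Set.Ico 0 e))
        (by rw [Real.volume_Ico]; exact ENNReal.ofReal_ne_top) (measure_mono ?_)
      refine Set.union_subset (Set.iUnion₂_subset fun m _ => Set.inter_subset_left)
        (Set.iUnion₂_subset fun i _ => Set.iUnion₂_subset fun m _ => Set.inter_subset_left)
    have hlen : e - s ≤ ∑ m ∈ K, service σ (κ, m) e +
        ∑ i ∈ higherPriority prio κ, ∑ m ∈ F i, service σ (i, m) e := by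
      rw [← Real.volume_real_Ioo_of_le hse.le]
      refine (measureReal_mono hcover hfin).trans ((measureReal_union_le _ _).trans ?_)
      refine add_le_add (measureReal_biUnion_finset_le _ _) ?_
      refine (measureReal_biUnion_finset_le _ _).trans (Finset.sum_le_sum fun i _ => ?_)
      exact measureReal_biUnion_finset_le _ _
    -- Strictness comes from job `j`, which is still unfinished at `e`.
    have hKsum : ∑ m ∈ K, service σ (κ, m) e < K.card * (τ κ).C := by
      rw [← nsmul_eq_mul, ← Finset.sum_const]
      exact Finset.sum_lt_sum (fun m _ => (hσ.service_le (κ, m) e).trans (P.c_le _ _))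
        ⟨j, hjK, ((service_mono _ hed).trans_lt hmiss).trans_le (P.c_le _ _)⟩
    refine hlen.trans_lt (add_lt_add_of_lt_of_le hKsum (Finset.sum_le_sum fun i _ => ?_))
    calc ∑ m ∈ F i, service σ (i, m) e ≤ ∑ m ∈ F i, (τ i).C :=
          Finset.sum_le_sum fun m _ => (hσ.service_le (i, m) e).trans (P.c_le _ _)
      _ = (τ i).C * ((F i).card : ℝ) := by rw [Finset.sum_const, nsmul_eq_mul, mul_comm]
      _ ≤ _ := by
        refine mul_le_mul_of_nonneg_left ?_ (τ i).C_pos.le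
        exact_mod_cast P.card_le_ceil i fun m hm => (Finset.mem_filter.1 hm).2

end Schedule

/-! ### Quadratic bound on the busy length. -/

/-- The sum of `u i * u j` over the pairs with `t i < t j` is at most half of the sum over all
pairs of distinct indices. -/
lemma sum_mul_sum_filter_lt_le {ι : Type*} (s : Finset ι) (u t : ι → ℝ) (hu : ∀ i ∈ s, 0 ≤ u i) :
    2 * ∑ i ∈ s, u i * ∑ j ∈ s.filter (fun j => t i < t j), u j ≤
      (∑ i ∈ s, u i) ^ 2 - ∑ i ∈ s, u i ^ 2 := by
  classical
  have h1 : ∀ i ∈ s, u i * ∑ j ∈ s.filter (fun j => t i < t j), u j =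
      ∑ j ∈ s, if t i < t j then u i * u j else 0 := fun i _ => by
    rw [Finset.mul_sum, Finset.sum_filter]
  have h2 : ∑ i ∈ s, u i ^ 2 = ∑ i ∈ s, ∑ j ∈ s, if i = j then u i * u j else 0 :=
    Finset.sum_congr rfl fun i hi => by rw [Finset.sum_ite_eq, if_pos hi, sq]
  have h3 : ∑ i ∈ s, ∑ j ∈ s, (if t i < t j then u i * u j else 0) =
      ∑ i ∈ s, ∑ j ∈ s, if t j < t i then u i * u j else 0 := by
    rw [Finset.sum_comm]
    simp only [mul_comm]
  rw [Finset.sum_congr rfl h1, le_sub_iff_add_le, two_mul]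
  -- One copy of the sum now runs over the reversed pairs; together with the diagonal they fit in
  -- the full square, ties being lost.
  nth_rewrite 2 [h3]
  rw [h2, sq, Finset.sum_mul_sum]
  simp only [← Finset.sum_add_distrib]
  refine Finset.sum_le_sum fun i hi => Finset.sum_le_sum fun j hj => ?_
  have := mul_nonneg (hu i hi) (hu j hj)
  by_cases hij : i = j
  · subst hij; simp
  · rcases lt_trichotomy (t i) (t j) with h | h | h
    · simp [h, h.not_gt, hij]
    · simp [h, hij, this]
    · simp [h, h.not_gt, hij]

/-- Quadratic bound on the length `L` of an interval in which the workload of the tasks in `s`,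
plus `A`, always exceeds the elapsed time. -/
lemma busy_length_lt {ι : Type*} (s : Finset ι) (C T : ι → ℝ) {A L M : ℝ}
    (hC : ∀ i ∈ s, 0 < C i) (hT : ∀ i ∈ s, 0 < T i) (hM : ∀ i ∈ s, T i ≤ M) (hM0 : 0 ≤ M)
    (hA : 0 ≤ A) (hL : 0 < L) (hS : ∑ i ∈ s, C i / T i < 1)
    (h : ∀ t, 0 < t → t ≤ L → t < A + ∑ i ∈ s, C i * (⌈t / T i⌉₊ : ℝ)) :
    (1 - ∑ i ∈ s, C i / T i) * L < A + M * (∑ i ∈ s, C i / T i -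
      (∑ i ∈ s, C i / T i) ^ 2 / 2 - (∑ i ∈ s, (C i / T i) ^ 2) / 2) := by
  set u : ι → ℝ := fun i => C i / T i with hu
  set t : ι → ℝ := fun i => ((⌈L / T i⌉₊ : ℝ) - 1) * T i with ht
  have hu0 : ∀ i ∈ s, 0 ≤ u i := fun i hi => (div_pos (hC i hi) (hT i hi)).le
  have hut : ∀ i ∈ s, C i = u i * T i := fun i hi => (div_mul_cancel₀ _ (hT i hi).ne').symm
  have hceil : ∀ i ∈ s, C i * (⌈L / T i⌉₊ : ℝ) = u i * t i + C i := fun i hi => by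
    have := (hT i hi).ne'
    simp only [hu, ht]; field_simp; ring
  have ht0 : ∀ i ∈ s, 0 ≤ t i := fun i hi => by
    have h1 : 1 ≤ ⌈L / T i⌉₊ := Nat.ceil_pos.2 (div_pos hL (hT i hi))
    have h2 : (1 : ℝ) ≤ (⌈L / T i⌉₊ : ℝ) := by exact_mod_cast h1
    exact mul_nonneg (by linarith) (hT i hi).le
  have htL : ∀ i ∈ s, t i < L := fun i hi => by
    have h1 := Nat.ceil_lt_add_one (div_pos hL (hT i hi)).le
    have h2 : (⌈L / T i⌉₊ : ℝ) - 1 < L / T i := by linarith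
    exact (lt_div_iff₀ (hT i hi)).1 h2
  set W := A + ∑ i ∈ s, u i * t i with hW
  have hLW : L < W + ∑ i ∈ s, C i := by
    have := h L hL le_rfl
    rw [Finset.sum_congr rfl hceil, Finset.sum_add_distrib] at this
    linarith
  have hW0 : 0 ≤ W := add_nonneg hA (Finset.sum_nonneg fun i hi => mul_nonneg (hu0 i hi) (ht0 i hi))
  -- Up to `t j`, a task with `t i ≥ t j` has released at least one job fewer than up to `L`; `W`
  -- omits that last job for every task.
  have htW : ∀ j ∈ s, t j ≤ W + ∑ i ∈ s, if t i < t j then C i else 0 := fun j hj => by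
    have hnn : 0 ≤ ∑ i ∈ s, if t i < t j then C i else 0 :=
      Finset.sum_nonneg fun i hi => by split_ifs; exacts [(hC i hi).le, le_rfl]
    rcases (ht0 j hj).eq_or_lt with h0 | h0
    · exact h0.symm.le.trans (add_nonneg hW0 hnn)
    · refine (h (t j) h0 (htL j hj).le).le.trans ?_
      rw [hW, add_assoc, ← Finset.sum_add_distrib]
      refine add_le_add_right (Finset.sum_le_sum fun i hi => ?_) A
      split_ifs with hij
      · rw [← hceil i hi]
        refine mul_le_mul_of_nonneg_left ?_ (hC i hi).le
        exact_mod_cast Nat.ceil_mono (div_le_div_of_nonneg_right (htL j hj).le (hT i hi).le)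
      · have h1 : (⌈t j / T i⌉₊ : ℝ) ≤ (⌈L / T i⌉₊ : ℝ) - 1 := by
          have h2 : 1 ≤ ⌈L / T i⌉₊ := Nat.ceil_pos.2 (div_pos hL (hT i hi))
          rw [← Nat.cast_one, ← Nat.cast_sub h2, Nat.cast_le, Nat.ceil_le,
            div_le_iff₀ (hT i hi), Nat.cast_sub h2, Nat.cast_one]
          exact not_lt.1 hij
        have h3 : u i * t i = C i * ((⌈L / T i⌉₊ : ℝ) - 1) := by
          rw [hut i hi]; simp only [ht]; ring
        rw [h3, add_zero]
        exact mul_le_mul_of_nonneg_left h1 (hC i hi).le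
  set S := ∑ i ∈ s, u i with hSdef
  have hWle : (1 - S) * W ≤ A + ∑ i ∈ s, C i * ∑ j ∈ s.filter (fun j => t i < t j), u j := by
    have h1 : ∑ j ∈ s, u j * t j ≤
        S * W + ∑ j ∈ s, u j * ∑ i ∈ s, if t i < t j then C i else 0 := by
      rw [hSdef, Finset.sum_mul, ← Finset.sum_add_distrib]
      refine Finset.sum_le_sum fun j hj => ?_
      rw [← mul_add]
      exact mul_le_mul_of_nonneg_left (htW j hj) (hu0 j hj)
    have h2 : ∑ j ∈ s, u j * (∑ i ∈ s, if t i < t j then C i else 0) =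
        ∑ i ∈ s, C i * ∑ j ∈ s.filter (fun j => t i < t j), u j := by
      simp only [Finset.sum_filter, Finset.mul_sum, mul_ite, mul_zero]
      rw [Finset.sum_comm]
      simp only [mul_comm]
    linarith
  -- Replacing `C i = u i * T i` by `M * u i` needs nonnegative coefficients, hence `S < 1`.
  have hcoef : ∑ i ∈ s, C i * (1 - S + ∑ j ∈ s.filter (fun j => t i < t j), u j) ≤
      M * ∑ i ∈ s, u i * (1 - S + ∑ j ∈ s.filter (fun j => t i < t j), u j) := by
    rw [Finset.mul_sum]
    refine Finset.sum_le_sum fun i hi => ?_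
    have h1 : 0 ≤ 1 - S + ∑ j ∈ s.filter (fun j => t i < t j), u j :=
      add_nonneg (by linarith) (Finset.sum_nonneg fun j hj => hu0 j (Finset.mem_filter.1 hj).1)
    rw [← mul_assoc, hut i hi]
    refine mul_le_mul_of_nonneg_right ?_ h1
    rw [mul_comm]
    exact mul_le_mul_of_nonneg_right (hM i hi) (hu0 i hi)
  simp only [mul_add, Finset.sum_add_distrib, ← Finset.sum_mul, ← hSdef] at hcoef
  have hpairs := sum_mul_sum_filter_lt_le s u t hu0
  have hmul := mul_le_mul_of_nonneg_left hpairs hM0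
  have hlast := mul_lt_mul_of_pos_left hLW (sub_pos.2 hS)
  rw [mul_add] at hlast
  rw [← hSdef] at hmul
  linarith

/-! ### From the closed-form conditions to the quadratic test. -/

/-- The quadratic schedulability test for a task of utilization `U` whose higher-priority tasks
have total utilization `S`, where `β = T / D` and `q = (k - 1) / k`. -/
structure QuadraticTest (β q S U : ℝ) : Prop where
  utilization_le : S + U ≤ 1
  quadratic_le : β * U + β * S + S - β * S ^ 2 / (2 * q) ≤ 1

lemma quadraticTest_of_le_hyperbolic {β q S U : ℝ} (hβ : 0 < β) (hq : 0 < q) (hq1 : q ≤ 1)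
    (hS : 0 ≤ S) (hU : 0 ≤ U) (htot : β < 1 → S + U ≤ 1)
    (h : S ≤ q / β * (1 + β - √(1 + β ^ 2 + 2 * β ^ 2 * U / q))) :
    QuadraticTest β q S U := by
  -- In the variable `y` the hypothesis says that `y` dominates the square root.
  obtain ⟨y, hy⟩ : ∃ y, y = 1 + β - β * S / q := ⟨_, rfl⟩
  have hSy : S = q / β * (1 + β - y) := by rw [hy]; field_simp; ring
  have hsy : √(1 + β ^ 2 + 2 * β ^ 2 * U / q) ≤ y := by
    rw [hSy, mul_le_mul_iff_right₀ (div_pos hq hβ)] at h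
    linarith
  have hy2 : 1 + β ^ 2 + 2 * β ^ 2 * U / q ≤ y ^ 2 := (Real.sqrt_le_iff.1 hsy).2
  have hy0 : 0 ≤ y := (Real.sqrt_nonneg _).trans hsy
  have hyle : y ≤ 1 + β := by
    have : 0 ≤ β * S / q := by positivity
    linarith
  have hUq : 2 * β ^ 2 * U ≤ q * (y ^ 2 - 1 - β ^ 2) := by
    have h1 : 2 * β ^ 2 * U / q ≤ y ^ 2 - 1 - β ^ 2 := by linarith
    rw [div_le_iff₀ hq] at h1
    linarith
  have hβy : β ≤ y := by
    refine le_of_sq_le_sq ?_ hy0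
    have : 0 ≤ 2 * β ^ 2 * U / q := by positivity
    linarith
  have hSβ : β * S = q * (1 + β - y) := by rw [hSy]; field_simp
  refine ⟨?_, ?_⟩
  · rcases lt_or_ge β 1 with h1 | h1
    · exact htot h1
    · have h2 : 2 * β ^ 2 * (S + U) ≤ 2 * β ^ 2 * 1 := by
        have h3 : 2 * β ^ 2 * (S + U) ≤ q * ((y - β) ^ 2 - 1 + 2 * β) := by
          linear_combination hUq + 2 * β * hSβ
        have h4 : (y - β) ^ 2 ≤ 1 := by nlinarith
        have h5 : q * ((y - β) ^ 2 - 1 + 2 * β) ≤ 1 * (2 * β) :=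
          mul_le_mul hq1 (by linarith) (by nlinarith) zero_le_one
        nlinarith
      exact le_of_mul_le_mul_left h2 (by positivity)
  · have h1 : β * S ^ 2 / (2 * q) = q * (1 + β - y) ^ 2 / (2 * β) := by
      rw [hSy]; field_simp
    have h2 : β * U ≤ q * (y ^ 2 - 1 - β ^ 2) / (2 * β) := by
      rw [le_div_iff₀ (by positivity)]; linarith
    have h3 : S + β * S = q * (1 + β - y) * (1 + β) / β := by rw [hSy]; field_simp
    have h4 : q * (y ^ 2 - 1 - β ^ 2) / (2 * β) + q * (1 + β - y) * (1 + β) / β -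
        q * (1 + β - y) ^ 2 / (2 * β) = q := by
      field_simp; ring
    linarith

/-- The assumption `β < √…` forces `S + U < q / β`, where `x - βx²/(2q)` is still increasing, so the
worst split is `U = 0`. -/
lemma quadraticTest_of_le_sqrt {β q S U : ℝ} (hβ : 0 < β) (hq : 1 / 2 ≤ q)
    (hU : 0 ≤ U) (hs : β < √((1 + β) ^ 2 - 2 * β / q))
    (h : S + U ≤ q / β * (1 + β - √((1 + β) ^ 2 - 2 * β / q))) :
    QuadraticTest β q S U := by
  have hq0 : 0 < q := by linarith
  set r := √((1 + β) ^ 2 - 2 * β / q) with hr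
  have hr2 : r ^ 2 = (1 + β) ^ 2 - 2 * β / q :=
    Real.sq_sqrt (Real.sqrt_pos.1 (hβ.trans hs)).le
  obtain ⟨W, hW⟩ : ∃ W, W = S + U := ⟨_, rfl⟩
  rw [← hW] at h
  obtain ⟨w, hw⟩ : ∃ w, w = β * W / q := ⟨_, rfl⟩
  have hWw : W = q / β * w := by rw [hw]; field_simp
  have hwr : w ≤ 1 + β - r := by
    rwa [hWw, mul_le_mul_iff_right₀ (div_pos hq0 hβ)] at h
  have hquad : (1 + β) * W - β * W ^ 2 / (2 * q) ≤ 1 := by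
    have h1 : r ^ 2 ≤ (1 + β - w) ^ 2 := by
      have : 0 < r := hβ.trans hs
      exact pow_le_pow_left₀ this.le (by linarith) 2
    have h2 : (1 + β) * W - β * W ^ 2 / (2 * q) = q / (2 * β) * ((1 + β) ^ 2 - (1 + β - w) ^ 2) := by
      rw [hWw]; field_simp; ring
    have h3 : (1 : ℝ) = q / (2 * β) * ((1 + β) ^ 2 - r ^ 2) := by
      rw [hr2]; field_simp; ring
    refine h2.trans_le (le_of_le_of_eq ?_ h3.symm)
    exact mul_le_mul_of_nonneg_left (by linarith) (by positivity)
  have hW1 : W ≤ 1 := by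
    have h1 : 1 + β - β / q ≤ r := by
      refine Real.le_sqrt_of_sq_le ?_
      have : (1 + β - β / q) ^ 2 = (1 + β) ^ 2 - 2 * β / q - β ^ 2 * (2 * q - 1) / q ^ 2 := by
        field_simp; ring
      rw [this]
      have : 0 ≤ β ^ 2 * (2 * q - 1) / q ^ 2 :=
        div_nonneg (mul_nonneg (sq_nonneg _) (by linarith)) (sq_nonneg _)
      linarith
    have h2 : w ≤ β / q := by linarith
    rw [hw] at h2
    have h3 : β * W ≤ β * 1 := by rw [mul_one]; exact (div_le_div_iff_of_pos_right hq0).1 h2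
    exact le_of_mul_le_mul_left h3 hβ
  refine ⟨hW ▸ hW1, ?_⟩
  have hw1 : β * W / q ≤ 1 := by rw [← hw]; linarith
  have h1 : 0 ≤ U * (1 - β * (W + S) / (2 * q)) := by
    refine mul_nonneg hU (sub_nonneg.2 (le_trans ?_ hw1))
    rw [div_le_div_iff₀ (by positivity) hq0]
    have : 0 ≤ β * U * q := mul_nonneg (mul_nonneg hβ.le hU) hq0.le
    rw [hW]
    linarith
  have h2 : U * (1 - β * (W + S) / (2 * q)) =
      (W - β * W ^ 2 / (2 * q)) - (S - β * S ^ 2 / (2 * q)) := by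
    rw [hW]; field_simp; ring
  subst hW
  linarith

/-- Completing the square, `S - βS²/(2q)` never exceeds `q/(2β)`, its value at `S = q/β`. -/
lemma quadraticTest_of_le_linear {β q S U : ℝ} (hβ : 0 < β) (hq : 1 / 2 ≤ q)
    (h : S + U ≤ 1 / β - q / (2 * β ^ 2)) : QuadraticTest β q S U := by
  have hq0 : 0 < q := by linarith
  constructor
  · have h1 : 1 / β - q / (2 * β ^ 2) = 1 - ((2 * β - 1) ^ 2 + (2 * q - 1)) / (4 * β ^ 2) := by
      field_simp; ring
    have h2 : 0 ≤ ((2 * β - 1) ^ 2 + (2 * q - 1)) / (4 * β ^ 2) :=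
      div_nonneg (add_nonneg (sq_nonneg _) (by linarith)) (by positivity)
    linarith
  · have h1 := mul_le_mul_of_nonneg_left h hβ.le
    have h2 : β * (1 / β - q / (2 * β ^ 2)) = 1 - q / (2 * β) := by field_simp
    have h3 : S - β * S ^ 2 / (2 * q) = q / (2 * β) - (q - β * S) ^ 2 / (2 * q * β) := by
      field_simp; ring
    have h4 : 0 ≤ (q - β * S) ^ 2 / (2 * q * β) := by positivity
    linarith

/-! ### Schedulability. -/

/-- The quadratic test guarantees schedulability if no higher-priority task has a larger period. -/
theorem schedulable_of_quadraticTest {ι : Type*} [Fintype ι] (τ : ι → SporadicTask) (prio : ι → ℕ)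
    (hprio : Function.Injective prio) (κ : ι)
    (hT : ∀ i ∈ higherPriority prio κ, (τ i).T ≤ (τ κ).T)
    (h : QuadraticTest ((τ κ).T / (τ κ).D)
      ((higherPriority prio κ).card / ((higherPriority prio κ).card + 1))
      (∑ i ∈ higherPriority prio κ, (τ i).U) (τ κ).U) :
    Schedulable τ prio κ := by
  intro P σ hσ j
  by_contra hmiss
  have hC := (τ κ).C_pos
  have hTκ := (τ κ).T_pos
  have hD := (τ κ).D_pos
  obtain ⟨s, n, hn, hns, hbusy⟩ :=
    hσ.exists_busy_window hprio (by linarith : P.r κ j ≤ P.r κ j + (τ κ).D) (not_le.1 hmiss)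
  have hn1 : (0 : ℝ) ≤ (n : ℝ) - 1 := sub_nonneg.2 (by exact_mod_cast hn)
  have hnT : 0 ≤ ((n : ℝ) - 1) * (τ κ).T := mul_nonneg hn1 hTκ.le
  have hUκ : 0 < (τ κ).U := div_pos hC hTκ
  have hCU : (τ κ).C = (τ κ).U * (τ κ).T := (div_mul_cancel₀ _ hTκ.ne').symm
  set S := ∑ i ∈ higherPriority prio κ, (τ i).U with hS
  obtain ⟨htot, hquad⟩ := h
  have hlen := busy_length_lt (higherPriority prio κ) (fun i => (τ i).C) (fun i => (τ i).T)
    (A := n * (τ κ).C) (L := ((n : ℝ) - 1) * (τ κ).T + (τ κ).D) (M := (τ κ).T)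
    (fun i _ => (τ i).C_pos) (fun i _ => (τ i).T_pos) hT hTκ.le
    (by positivity) (by linarith)
    (by
      change S < 1
      linarith)
    (fun t ht0 htL => by
      have := hbusy (s + t) (by linarith) (by linarith)
      rwa [add_sub_cancel_left] at this)
  change (1 - S) * _ < _ + _ * (S - S ^ 2 / 2 -
    (∑ i ∈ higherPriority prio κ, (τ i).U ^ 2) / 2) at hlen
  have hcauchy : S ^ 2 ≤ (higherPriority prio κ).card *
      ∑ i ∈ higherPriority prio κ, (τ i).U ^ 2 := sq_sum_le_card_mul_sum_sq
  have hsq : S ^ 2 / (2 * ((higherPriority prio κ).card / ((higherPriority prio κ).card + 1))) ≤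
      S ^ 2 / 2 + (∑ i ∈ higherPriority prio κ, (τ i).U ^ 2) / 2 := by
    -- Without higher-priority tasks the left side is a division by zero, hence `0`.
    rcases (higherPriority prio κ).card.eq_zero_or_pos with h0 | h0
    · rw [h0]
      simp only [Nat.cast_zero, zero_div, mul_zero, div_zero]
      exact add_nonneg (by positivity)
        (div_nonneg (Finset.sum_nonneg fun i _ => sq_nonneg _) two_pos.le)
    · have hm : (0 : ℝ) < (higherPriority prio κ).card := by exact_mod_cast h0
      have h1 : S ^ 2 / (2 * ((higherPriority prio κ).card /
          (((higherPriority prio κ).card : ℝ) + 1))) =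
          S ^ 2 / 2 + S ^ 2 / (higherPriority prio κ).card / 2 := by
        field_simp
      rw [h1]
      have h2 := (div_le_iff₀' hm).2 hcauchy
      linarith
  have hlin : (τ κ).D * ((τ κ).T / (τ κ).D * (τ κ).U + (τ κ).T / (τ κ).D * S + S -
      (τ κ).T / (τ κ).D * S ^ 2 /
        (2 * ((higherPriority prio κ).card / ((higherPriority prio κ).card + 1)))) =
      (τ κ).C + (τ κ).T * S + (τ κ).D * S - (τ κ).T *
        (S ^ 2 / (2 * ((higherPriority prio κ).card / ((higherPriority prio κ).card + 1)))) := by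
    rw [hCU, mul_div_assoc _ (S ^ 2)]
    field_simp
  have h1 := mul_le_mul_of_nonneg_left hquad hD.le
  rw [hlin] at h1
  have h2 := mul_le_mul_of_nonneg_left hsq hTκ.le
  -- Each extra job adds `T_κ` to the window and only `C_κ` to the demand, so `n = 1` is worst.
  have h3 : 0 ≤ ((n : ℝ) - 1) * (τ κ).T * (1 - S - (τ κ).U) :=
    mul_nonneg hnT (by linarith)
  have h4 : ((n : ℝ) - 1) * (τ κ).T * (1 - S - (τ κ).U) =
      (1 - S) * (((n : ℝ) - 1) * (τ κ).T) - ((n : ℝ) - 1) * (τ κ).C := by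
    rw [hCU]; ring
  linarith

theorem corollary2 {ι : Type*} [Fintype ι] (τ : ι → SporadicTask) (prio : ι → ℕ)
    (hRM : IsRateMonotonic τ prio) (κ : ι)
    (k : ℕ) (hk : k = (higherPriority prio κ).card + 1) (hk2 : 2 ≤ k)
    (β : ℝ) (hβ : β = (τ κ).T / (τ κ).D)
    (h :
      ((β < 1 → (∑ i ∈ higherPriority prio κ, (τ i).U) + (τ κ).U ≤ 1) ∧
        ∑ i ∈ higherPriority prio κ, (τ i).U ≤
          (((k : ℝ) - 1) / (β * (k : ℝ))) *
            (1 + β - Real.sqrt (1 + β ^ 2 +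
              2 * β ^ 2 * (τ κ).U * ((k : ℝ) / ((k : ℝ) - 1))))) ∨
      ((∑ i ∈ higherPriority prio κ, (τ i).U) + (τ κ).U ≤
        if (k : ℝ) > 2 * β + 1 then
          (((k : ℝ) - 1) / (β * (k : ℝ))) *
            (1 + β - Real.sqrt (1 + β ^ 2 - 2 * β / ((k : ℝ) - 1)))
        else
          1 / β - ((k : ℝ) - 1) / (2 * β ^ 2 * (k : ℝ)))) :
    Schedulable τ prio κ := by
  have hm : 1 ≤ (higherPriority prio κ).card := by omega
  have hm' : (1 : ℝ) ≤ (higherPriority prio κ).card := by exact_mod_cast hm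
  have hkR : (k : ℝ) = (higherPriority prio κ).card + 1 := by exact_mod_cast hk
  have hβ0 : 0 < β := hβ ▸ div_pos (τ κ).T_pos (τ κ).D_pos
  have hT : ∀ i ∈ higherPriority prio κ, (τ i).T ≤ (τ κ).T := fun i hi => by
    by_contra hlt
    exact (Finset.mem_filter.1 hi).2.not_gt (hRM.lt_of_period_lt _ _ (not_le.1 hlt))
  have hS : 0 ≤ ∑ i ∈ higherPriority prio κ, (τ i).U :=
    Finset.sum_nonneg fun i _ => (div_pos (τ i).C_pos (τ i).T_pos).le
  have hU : 0 ≤ (τ κ).U := (div_pos (τ κ).C_pos (τ κ).T_pos).le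
  refine schedulable_of_quadraticTest τ prio hRM.injective κ hT ?_
  rw [← hβ]
  generalize ((higherPriority prio κ).card : ℝ) = m at hm' hkR ⊢
  generalize ∑ i ∈ higherPriority prio κ, (τ i).U = S at h hS ⊢
  rw [hkR, add_sub_cancel_right] at h
  have hm0 : 0 < m := by linarith
  have hq : 1 / 2 ≤ m / (m + 1) := by
    rw [div_le_div_iff₀ two_pos (by linarith)]; linarith
  have hq1 : m / (m + 1) ≤ 1 := (div_le_one (by linarith)).2 (by linarith)
  have hcoef : m / (β * (m + 1)) = m / (m + 1) / β := by field_simp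
  rcases h with ⟨htot, h⟩ | h
  · refine quadraticTest_of_le_hyperbolic hβ0 (by linarith) hq1 hS hU htot ?_
    have harg : 2 * β ^ 2 * (τ κ).U * ((m + 1) / m) = 2 * β ^ 2 * (τ κ).U / (m / (m + 1)) := by
      field_simp
    rwa [hcoef, harg] at h
  · split_ifs at h with hcase
    · have harg : 1 + β ^ 2 - 2 * β / m = (1 + β) ^ 2 - 2 * β / (m / (m + 1)) := by
        field_simp; ring
      rw [hcoef, harg] at h
      refine quadraticTest_of_le_sqrt hβ0 hq hU ?_ h
      rw [← harg]
      -- The case `k > 2β + 1` is exactly where the root exceeds `β`.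
      refine Real.lt_sqrt_of_sq_lt ?_
      have : 2 * β / m < 1 := (div_lt_one hm0).2 (by linarith)
      linarith
    · refine quadraticTest_of_le_linear hβ0 hq (h.trans_eq ?_)
      field_simp
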